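/- Let $X$ be a strictly convex real Banach space of dimension $2$, with unit sphere $S_X=\{x\in X:\|x\|=1\}$, and let $c\in S_X$ be a non-smooth point, that is, a point for which there is not exactly one continuous linear functional $x^*:X\to\mathbb R$ with $x^*(c)=1=\|x^*\|$. Then $c$ is special: for every real Banach space $Y$ with unit sphere $S_Y$, every bijective isometry $f:S_X\to S_Y$ and all points $y,z\in S_X$ with $y-z=\|y-z\|\cdot c$, we have $$f(y)-f(z)=\|f(y)-f(z)\|\cdot f(c)=\|y-z\|\cdot f(c).$$ -/

import Mathlib

universe u v

/-- A point `x` of the unit sphere `S_X` is smooth if there is exactly one continuous linear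
functional `φ : X → ℝ` with `φ x = 1 = ‖φ‖`. -/
def IsSmoothPoint {X : Type u} [NormedAddCommGroup X] [NormedSpace ℝ X]
    (x : Metric.sphere (0 : X) 1) : Prop :=
  ∃! φ : X →L[ℝ] ℝ, φ (x : X) = 1 ∧ ‖φ‖ = 1

/-- A point `x` of the unit sphere `S_X` is special if, for every bijective isometry `f` from `S_X`
to the unit sphere of a real Banach space `Y` and all `y, z ∈ S_X` with `y - z = ‖y - z‖ • x`, one
has `f y - f z = ‖f y - f z‖ • f x = ‖y - z‖ • f x`. The space `Y` ranges over all real Banach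
spaces of a universe `v` that is unrelated to the universe of `X`. -/
def IsSpecialPoint {X : Type u} [NormedAddCommGroup X] [NormedSpace ℝ X]
    (x : Metric.sphere (0 : X) 1) : Prop :=
  ∀ (Y : Type v) [NormedAddCommGroup Y] [NormedSpace ℝ Y] [CompleteSpace Y]
    (f : Metric.sphere (0 : X) 1 → Metric.sphere (0 : Y) 1),
    Isometry f → Function.Bijective f →
    ∀ y z : Metric.sphere (0 : X) 1,
      (y : X) - (z : X) = ‖(y : X) - (z : X)‖ • (x : X) →
      (f y : Y) - (f z : Y) = ‖(f y : Y) - (f z : Y)‖ • (f x : Y) ∧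
      ‖(f y : Y) - (f z : Y)‖ • (f x : Y) = ‖(y : X) - (z : X)‖ • (f x : Y)

open Filter Topology Module

/-! The chords of the unit ball parallel to `c` form a one-parameter family `u`, and `f` preserves
their lengths. Let `g u` be the unit direction of the image chord; it suffices that `g` is constant,
since the chord through the origin has direction `f c`. Fix one end of a chord and move the other
along the sphere. The two supports at `c` give two candidate derivatives for the distance, so it is
not differentiable (`not_differentiableAt_norm_sub_of_two_supports`), and neither is the equal
distance in `Y`. But if `g' ≠ 0`, the unit circle of the plane `Y` has a tangent at `g u`, which
makes that distance differentiable (`eq_zero_of_hasDerivAt_of_not_differentiableAt_norm`). So `g' =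
0` wherever the derivatives exist, which is almost everywhere; absolute continuity then makes `g`
constant. -/

theorem exists_eq_smul_add_smul_of_finrank_eq_two {E : Type*} [AddCommGroup E] [Module ℝ E]
    (hdim : finrank ℝ E = 2) {v w : E} (h : LinearIndependent ℝ ![v, w]) (x : E) :
    ∃ a b : ℝ, x = a • v + b • w := by
  have htop := h.span_eq_top_of_card_eq_finrank (by simp [hdim])
  have hx : x ∈ Submodule.span ℝ (Set.range ![v, w]) := htop ▸ Submodule.mem_top
  rw [Matrix.range_cons, Matrix.range_cons, Matrix.range_empty, Set.union_empty,
    Set.singleton_union, Submodule.mem_span_pair] at hx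
  obtain ⟨a, b, hab⟩ := hx
  exact ⟨a, b, hab.symm⟩

theorem hasDerivAt_add_mul_sub (b a u : ℝ) : HasDerivAt (fun s => b + a * (s - u)) a u := by
  have := (((hasDerivAt_id u).sub_const u).const_mul a).const_add b
  rwa [mul_one] at this

/-! ### Differentiability of the norm along curves -/

section NormAlongCurves

variable {E : Type*} [NormedAddCommGroup E] [NormedSpace ℝ E]

/-- Whether the norm is differentiable along a curve depends only on the tangent vector. -/
theorem HasDerivAt.norm_congr_of_tangent {k l : ℝ → E} {v : E} {x d : ℝ} (hk : HasDerivAt k v x)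
    (hl : HasDerivAt l v x) (hkl : k x = l x) (h : HasDerivAt (fun s => ‖l s‖) d x) :
    HasDerivAt (fun s => ‖k s‖) d x := by
  have h0 := hk.sub hl
  rw [sub_self, hasDerivAt_iff_isLittleO] at h0
  have h1 : (fun s => ‖k s‖ - ‖l s‖) =o[𝓝 x] fun s => s - x := by
    refine Asymptotics.IsLittleO.of_norm_left
      (Asymptotics.IsBigO.trans_isLittleO (Asymptotics.IsBigO.of_bound 1 ?_) h0)
    refine Eventually.of_forall fun s => ?_
    simpa [hkl] using abs_norm_sub_norm_le (k s) (l s)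
  rw [hasDerivAt_iff_isLittleO] at h ⊢
  refine (h.add h1).congr_left fun s => ?_
  simp only [hkl]
  ring

/-- A unit-norm curve with nonzero velocity at `g u` provides, in a plane, a curve of differentiable
norm with any prescribed tangent vector through `r • g u`. -/
theorem eq_zero_of_hasDerivAt_of_not_differentiableAt_norm (hdim : finrank ℝ E = 2)
    {g k : ℝ → E} {v w : E} {u r : ℝ} (hg : HasDerivAt g w u) (hnorm : ∀ᶠ s in 𝓝 u, ‖g s‖ = 1)
    (hk : HasDerivAt k v u) (hr : 0 < r) (hku : k u = r • g u)
    (hnd : ¬ DifferentiableAt ℝ (fun s => ‖k s‖) u) : w = 0 := by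
  have hgu : ‖g u‖ = 1 := hnorm.self_of_nhds
  have hgu0 : g u ≠ 0 := by
    intro h
    simp [h] at hgu
  have hgnorm : HasDerivAt (fun s => ‖g s‖) 0 u :=
    (hasDerivAt_const u (1 : ℝ)).congr_of_eventuallyEq hnorm
  by_cases hli : LinearIndependent ℝ ![g u, w]
  · exfalso
    obtain ⟨a, b, hab⟩ := exists_eq_smul_add_smul_of_finrank_eq_two hdim hli v
    -- Polar form: `n s • g (m s)` has norm `n s` near `u`, and the slopes of `n` and `m` are chosen
    -- so that its velocity is `a • g u + b • w = v`.
    set m : ℝ → ℝ := fun s => u + (b / r) * (s - u) with hm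
    set n : ℝ → ℝ := fun s => r + a * (s - u) with hn
    have hmu : m u = u := by simp [hm]
    have hnu : n u = r := by simp [hn]
    have hmd : HasDerivAt m (b / r) u := by
      exact hasDerivAt_add_mul_sub u (b / r) u
    have hnd' : HasDerivAt n a u := by
      exact hasDerivAt_add_mul_sub r a u
    have hgm : HasDerivAt (fun s => g (m s)) ((b / r) • w) u :=
      HasDerivAt.scomp u (by rwa [hmu]) hmd
    have hl : HasDerivAt (fun s => n s • g (m s)) v u := by
      have := hnd'.smul hgm
      rw [hnu, hmu, smul_smul, mul_div_cancel₀ _ hr.ne', add_comm, ← hab] at this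
      exact this
    have hpos : ∀ᶠ s in 𝓝 u, 0 < n s :=
      hnd'.continuousAt.eventually (by rw [hnu]; exact lt_mem_nhds hr)
    have hone : ∀ᶠ s in 𝓝 u, ‖g (m s)‖ = 1 :=
      hmd.continuousAt.eventually (p := fun s => ‖g s‖ = 1) (by rwa [hmu])
    have hln : HasDerivAt (fun s => ‖n s • g (m s)‖) a u := by
      refine hnd'.congr_of_eventuallyEq ?_
      filter_upwards [hpos, hone] with s h1 h2
      rw [norm_smul, h2, mul_one, Real.norm_of_nonneg h1.le]
    exact hnd (hk.norm_congr_of_tangent hl (by rw [hku, hnu, hmu]) hln).differentiableAt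
  · rw [LinearIndependent.pair_iff' hgu0] at hli
    push Not at hli
    obtain ⟨a, ha⟩ := hli
    -- If `w = a • g u`, the norm along `g` has derivative `a`; being constant, it forces `a = 0`.
    have hnd' : HasDerivAt (fun s => 1 + a * (s - u)) a u :=
      hasDerivAt_add_mul_sub 1 a u
    have hpos : ∀ᶠ s in 𝓝 u, 0 < 1 + a * (s - u) :=
      hnd'.continuousAt.eventually (lt_mem_nhds (by simp))
    have hln : HasDerivAt (fun s => ‖(1 + a * (s - u)) • g u‖) a u := by
      refine hnd'.congr_of_eventuallyEq ?_
      filter_upwards [hpos] with s h1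
      rw [norm_smul, hgu, mul_one, Real.norm_of_nonneg h1.le]
    have := hg.norm_congr_of_tangent (ha ▸ hnd'.smul_const (g u)) (by simp) hln
    rw [← ha, ← hgnorm.unique this, zero_smul]

/-- Norm minus support is nonnegative and vanishes at `u`, so a derivative of the norm would have to
equal both `φ₁ y'` and `φ₂ y'`. -/
theorem not_differentiableAt_norm_sub_of_two_supports {φ₁ φ₂ : E →L[ℝ] ℝ} (h₁ : ‖φ₁‖ ≤ 1)
    (h₂ : ‖φ₂‖ ≤ 1) {y : ℝ → E} {y' z : E} {u : ℝ} (hy : HasDerivAt y y' u)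
    (hu₁ : φ₁ (y u - z) = ‖y u - z‖) (hu₂ : φ₂ (y u - z) = ‖y u - z‖) (hne : φ₁ y' ≠ φ₂ y') :
    ¬ DifferentiableAt ℝ (fun s => ‖y s - z‖) u := by
  intro hd
  have key : ∀ φ : E →L[ℝ] ℝ, ‖φ‖ ≤ 1 → φ (y u - z) = ‖y u - z‖ →
      deriv (fun s => ‖y s - z‖) u = φ y' := by
    intro φ hφ hφu
    have hd1 := hd.hasDerivAt.sub (φ.hasFDerivAt.comp_hasDerivAt u (hy.sub_const z))
    have hmin : IsLocalMin ((fun s => ‖y s - z‖) - (φ ∘ fun s => y s - z)) u := by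
      refine Eventually.of_forall fun s => ?_
      simp only [Pi.sub_apply, Function.comp_apply, hφu, sub_self]
      have := (le_abs_self _).trans ((φ.le_opNorm (y s - z)).trans
        (mul_le_of_le_one_left (norm_nonneg _) hφ))
      linarith
    exact sub_eq_zero.1 (hmin.hasDerivAt_eq_zero hd1)
  exact hne ((key φ₁ h₁ hu₁).symm.trans (key φ₂ h₂ hu₂))

end NormAlongCurves

/-! ### Sections of the unit ball by parallel lines -/

section Sections

variable {E : Type*} [NormedAddCommGroup E] [NormedSpace ℝ E]

/-- The `u` for which the line `u • e + ℝ • c` meets the open unit ball. -/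
def ballSectionDomain (e c : E) : Set ℝ := {u | ∃ t : ℝ, ‖u • e + t • c‖ < 1}

/-- The largest `t` for which `u • e + t • c` lies in the closed unit ball. -/
noncomputable def ballSectionTop (e c : E) (u : ℝ) : ℝ := sSup {t : ℝ | ‖u • e + t • c‖ ≤ 1}

/-- The endpoint of the section of the unit ball by the line `u • e + ℝ • c`. -/
noncomputable def ballSectionEnd (e c : E) (u : ℝ) : E := u • e + ballSectionTop e c u • c

theorem isOpen_ballSectionDomain (e c : E) : IsOpen (ballSectionDomain e c) := by
  have : ballSectionDomain e c = ⋃ t : ℝ, {u | ‖u • e + t • c‖ < 1} := by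
    ext u; simp [ballSectionDomain]
  rw [this]
  exact isOpen_iUnion fun t => isOpen_lt (by fun_prop) continuous_const

theorem norm_combo_smul_add_smul_le {e c : E} {a b : ℝ} (ha : 0 ≤ a) (hb : 0 ≤ b)
    (u v s t : ℝ) : ‖(a * u + b * v) • e + (a * s + b * t) • c‖ ≤
      a * ‖u • e + s • c‖ + b * ‖v • e + t • c‖ := by
  have : (a * u + b * v) • e + (a * s + b * t) • c =
      a • (u • e + s • c) + b • (v • e + t • c) := by module
  rw [this]
  refine (norm_add_le _ _).trans ?_
  rw [norm_smul, norm_smul, Real.norm_of_nonneg ha, Real.norm_of_nonneg hb]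

theorem convex_ballSectionDomain (e c : E) : Convex ℝ (ballSectionDomain e c) := by
  rintro u ⟨s, hs⟩ v ⟨t, ht⟩ a b ha hb hab
  refine ⟨a * s + b * t, (norm_combo_smul_add_smul_le ha hb u v s t).trans_lt ?_⟩
  rcases ha.eq_or_lt with rfl | ha
  · have : b = 1 := by linarith
    simpa [this] using ht
  · nlinarith [mul_lt_mul_of_pos_left hs ha, mul_le_mul_of_nonneg_left ht.le hb]

theorem neg_mem_ballSectionDomain {e c : E} {u : ℝ} (hu : u ∈ ballSectionDomain e c) :
    -u ∈ ballSectionDomain e c := by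
  obtain ⟨t, ht⟩ := hu
  refine ⟨-t, ?_⟩
  rwa [← norm_neg, show -(-u • e + -t • c) = u • e + t • c by module]

theorem bddAbove_ballSection {e c : E} (hc : ‖c‖ = 1) (u : ℝ) :
    BddAbove {t : ℝ | ‖u • e + t • c‖ ≤ 1} := by
  refine ⟨1 + ‖u • e‖, fun t ht => ?_⟩
  have h1 : ‖t • c‖ ≤ ‖u • e + t • c‖ + ‖u • e‖ := by
    simpa using norm_sub_le (u • e + t • c) (u • e)
  rw [norm_smul, hc, mul_one] at h1
  have := le_abs_self t
  rw [Real.norm_eq_abs] at h1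
  have h2 : ‖u • e + t • c‖ ≤ 1 := ht
  linarith

theorem norm_ballSectionEnd_le {e c : E} (hc : ‖c‖ = 1) {u : ℝ}
    (hu : u ∈ ballSectionDomain e c) : ‖ballSectionEnd e c u‖ ≤ 1 := by
  obtain ⟨t, ht⟩ := hu
  have hclosed : IsClosed {t : ℝ | ‖u • e + t • c‖ ≤ 1} :=
    isClosed_le (by fun_prop) continuous_const
  exact hclosed.csSup_mem ⟨t, ht.le⟩ (bddAbove_ballSection hc u)

theorem lt_ballSectionTop {e c : E} (hc : ‖c‖ = 1) {u t : ℝ} (ht : ‖u • e + t • c‖ < 1) :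
    t < ballSectionTop e c u := by
  set δ := 1 - ‖u • e + t • c‖ with hδ
  have hδ0 : 0 < δ := by linarith
  refine (lt_add_of_pos_right t hδ0).trans_le (le_csSup (bddAbove_ballSection hc u) ?_)
  change ‖u • e + (t + δ) • c‖ ≤ 1
  rw [add_smul, ← add_assoc]
  refine (norm_add_le _ _).trans ?_
  rw [norm_smul, hc, Real.norm_of_nonneg hδ0.le]
  linarith

theorem norm_ballSectionEnd {e c : E} (hc : ‖c‖ = 1) {u : ℝ} (hu : u ∈ ballSectionDomain e c) :
    ‖ballSectionEnd e c u‖ = 1 := by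
  refine (norm_ballSectionEnd_le hc hu).antisymm (not_lt.1 fun h => ?_)
  exact lt_irrefl _ (lt_ballSectionTop hc h)

theorem ballSectionTop_add_neg_pos {e c : E} (hc : ‖c‖ = 1) {u : ℝ}
    (hu : u ∈ ballSectionDomain e c) : 0 < ballSectionTop e c u + ballSectionTop e c (-u) := by
  obtain ⟨t, ht⟩ := hu
  have h1 := lt_ballSectionTop hc ht
  have h2 : -t < ballSectionTop e c (-u) := by
    refine lt_ballSectionTop hc ?_
    rwa [← norm_neg, show -(-u • e + -t • c) = u • e + t • c by module]
  linarith

theorem ballSectionTop_zero {c : E} (e : E) (hc : ‖c‖ = 1) : ballSectionTop e c 0 = 1 := by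
  refine le_antisymm (csSup_le ⟨0, by simp⟩ fun t ht => ?_)
    (le_csSup (bddAbove_ballSection hc 0) (by simp [hc]))
  have : |t| ≤ 1 := by simpa [norm_smul, hc] using ht
  exact (le_abs_self t).trans this

theorem concaveOn_ballSectionTop {c : E} (e : E) (hc : ‖c‖ = 1) :
    ConcaveOn ℝ (ballSectionDomain e c) (ballSectionTop e c) := by
  refine ⟨convex_ballSectionDomain e c, fun u hu v hv a b ha hb hab => ?_⟩
  refine le_csSup (bddAbove_ballSection hc _) ?_
  refine (norm_combo_smul_add_smul_le ha hb u v _ _).trans ?_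
  have h1 := mul_le_mul_of_nonneg_left (norm_ballSectionEnd_le hc hu) ha
  have h2 := mul_le_mul_of_nonneg_left (norm_ballSectionEnd_le hc hv) hb
  unfold ballSectionEnd at h1 h2
  linarith

/-- By strict convexity the open chord lies in the open ball, so a line meeting the sphere twice has
no point of the ball beyond the second one. -/
theorem eq_ballSectionTop_of_lt [StrictConvexSpace ℝ E] {e c : E} (hc : ‖c‖ = 1) {u s t : ℝ}
    (hst : s < t) (hs : ‖u • e + s • c‖ = 1) (ht : ‖u • e + t • c‖ = 1) :
    u ∈ ballSectionDomain e c ∧ t = ballSectionTop e c u := by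
  have hc0 : c ≠ 0 := by rintro rfl; simp at hc
  have between : ∀ r, s < r → ‖u • e + r • c‖ ≤ 1 → ∀ q, s < q → q < r →
      ‖u • e + q • c‖ < 1 := by
    intro r hsr hr q hq hqr
    have hrs : 0 < r - s := sub_pos.2 hsr
    have hne : u • e + s • c ≠ u • e + r • c := by
      intro h
      exact hsr.ne (smul_left_injective ℝ hc0 (add_left_cancel h))
    have := norm_combo_lt_of_ne hs.le hr hne (div_pos (sub_pos.2 hqr) hrs)
      (div_pos (sub_pos.2 hq) hrs) (by field_simp; ring)
    convert this using 2
    have h1 : (r - q) / (r - s) + (q - s) / (r - s) = 1 := by field_simp; ring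
    have h2 : (r - q) / (r - s) * s + (q - s) / (r - s) * r = q := by field_simp; ring
    calc u • e + q • c = ((r - q) / (r - s) + (q - s) / (r - s)) • u • e +
          ((r - q) / (r - s) * s + (q - s) / (r - s) * r) • c := by rw [h1, h2, one_smul]
      _ = _ := by module
  have hu : u ∈ ballSectionDomain e c :=
    ⟨(s + t) / 2, between t hst ht.le _ (by linarith) (by linarith)⟩
  refine ⟨hu, (le_csSup (bddAbove_ballSection hc u) ht.le).antisymm (not_lt.1 fun h => ?_)⟩
  exact (between _ (hst.trans h) (norm_ballSectionEnd_le hc hu) t hst h).ne ht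

end Sections

/-! ### Constancy of the direction of the image chords -/

section Directions

theorem LipschitzOnWith.absolutelyContinuousOnInterval_inv {H : ℝ → ℝ} {K : NNReal} {a b : ℝ}
    (hH : LipschitzOnWith K H (Set.uIcc a b)) (hpos : ∀ u ∈ Set.uIcc a b, 0 < H u) :
    AbsolutelyContinuousOnInterval (fun u => (H u)⁻¹) a b := by
  obtain ⟨x, hx, hmin⟩ := isCompact_uIcc.exists_isMinOn Set.nonempty_uIcc hH.continuousOn
  have hx0 := hpos x hx
  refine LipschitzOnWith.absolutelyContinuousOnInterval
    (K := K * Real.toNNReal ((H x * H x)⁻¹)) (LipschitzOnWith.of_dist_le_mul fun s hs t ht => ?_)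
  have h1 := hH.dist_le_mul s hs t ht
  rw [dist_inv_inv₀ (hpos s hs).ne' (hpos t ht).ne', Real.norm_of_nonneg (hpos s hs).le,
    Real.norm_of_nonneg (hpos t ht).le, div_eq_mul_inv, NNReal.coe_mul,
    Real.coe_toNNReal _ (by positivity), mul_right_comm]
  have h2 : (H s * H t)⁻¹ ≤ (H x * H x)⁻¹ := by
    gcongr
    · exact (hpos s hs).le
    · exact hmin hs
    · exact hmin ht
  have h3 : 0 ≤ (H s * H t)⁻¹ := inv_nonneg.2 (mul_nonneg (hpos s hs).le (hpos t ht).le)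
  exact mul_le_mul h1 h2 h3 (dist_nonneg.trans h1)

variable {X Y : Type*} [NormedAddCommGroup X] [NormedSpace ℝ X] [NormedAddCommGroup Y]
  [NormedSpace ℝ Y]

/-- An odd map of unit spheres preserving distances maps the chords parallel to a non-smooth point
`c` to chords of a fixed direction. -/
theorem isometry_ballSectionEnd_add_neg (hdim : finrank ℝ Y = 2) {e c : X} (hc : ‖c‖ = 1)
    {φ₁ φ₂ : X →L[ℝ] ℝ} (h₁ : ‖φ₁‖ ≤ 1) (h₂ : ‖φ₂‖ ≤ 1) (hc₁ : φ₁ c = 1) (hc₂ : φ₂ c = 1)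
    (he : φ₁ e ≠ φ₂ e) {F : X → Y} (hF : ∀ x y, ‖x‖ = 1 → ‖y‖ = 1 → ‖F x - F y‖ = ‖x - y‖)
    (hodd : ∀ x, ‖x‖ = 1 → F (-x) = -F x) {u₀ : ℝ} (hu₀ : u₀ ∈ ballSectionDomain e c) :
    F (ballSectionEnd e c u₀) + F (ballSectionEnd e c (-u₀)) =
      (ballSectionTop e c u₀ + ballSectionTop e c (-u₀)) • F c := by
  have : FiniteDimensional ℝ Y := .of_finrank_pos (by omega)
  set I := ballSectionDomain e c with hI
  set p := ballSectionTop e c with hp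
  set y := ballSectionEnd e c with hy
  have hydef : ∀ u, y u = u • e + p u • c := fun u => rfl
  have hIo : IsOpen I := isOpen_ballSectionDomain e c
  have hy1 : ∀ u ∈ I, ‖y u‖ = 1 := fun u hu => norm_ballSectionEnd hc hu
  have hIneg : ∀ u ∈ I, -u ∈ I := fun u hu => neg_mem_ballSectionDomain hu
  set H : ℝ → ℝ := fun u => p u + p (-u) with hH
  have hHpos : ∀ u ∈ I, 0 < H u := fun u hu => ballSectionTop_add_neg_pos hc hu
  set A : ℝ → Y := fun u => F (y u) with hA
  set B : ℝ → Y := fun u => F (y (-u)) with hB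
  -- The lower end of the chord at `u` is `-y (-u)`, so oddness of `F` turns chord differences into
  -- sums.
  have hchord : ∀ u, y u + y (-u) = H u • c := fun u => by
    rw [hydef, hydef]; simp only [hH]; module
  have hAB : ∀ s ∈ I, ∀ t ∈ I, ‖A s + B t‖ = ‖y s - -y (-t)‖ := fun s hs t ht => by
    rw [← hF _ _ (hy1 s hs) (by rw [norm_neg]; exact hy1 _ (hIneg t ht)),
      hodd _ (hy1 _ (hIneg t ht)), sub_neg_eq_add]
  have hABnorm : ∀ u ∈ I, ‖A u + B u‖ = H u := fun u hu => by
    rw [hAB u hu u hu, sub_neg_eq_add, hchord, norm_smul, hc, mul_one,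
      Real.norm_of_nonneg (hHpos u hu).le]
  set J := Set.uIcc (-u₀) u₀ with hJ
  have hJI : J ⊆ I := by
    rw [hJ, ← segment_eq_uIcc]
    exact (convex_ballSectionDomain e c).segment_subset (hIneg _ hu₀) hu₀
  have hJneg : ∀ u ∈ J, -u ∈ J := fun u hu => by
    rw [hJ, Set.mem_uIcc] at hu ⊢
    rcases hu with hu | hu
    · left; constructor <;> linarith [hu.1, hu.2]
    · right; constructor <;> linarith [hu.1, hu.2]
  -- Concavity makes `p` Lipschitz on compact subsets of the open domain.
  obtain ⟨K, hK⟩ := (((concaveOn_ballSectionTop e hc).locallyLipschitzOn hIo).mono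
    hJI).exists_lipschitzOnWith_of_compact (isCompact_uIcc : IsCompact J)
  have hnegL : LipschitzOnWith 1 (fun u : ℝ => -u) J :=
    LipschitzOnWith.of_dist_le_mul fun s _ t _ => by simp
  have hpneg : LipschitzOnWith (K * 1) (fun u => p (-u)) J := hK.comp hnegL hJneg
  have hAL : LipschitzOnWith (‖e‖₊ + K) A J := by
    refine LipschitzOnWith.of_dist_le_mul fun s hs t ht => ?_
    have h1 := hK.dist_le_mul s hs t ht
    have h2 : y s - y t = (s - t) • e + (p s - p t) • c := by
      rw [hydef, hydef]; module
    rw [dist_eq_norm, hF _ _ (hy1 s (hJI hs)) (hy1 t (hJI ht)), h2]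
    refine (norm_add_le _ _).trans ?_
    rw [norm_smul, norm_smul, hc, mul_one, ← dist_eq_norm, ← dist_eq_norm]
    push_cast
    linarith
  have hBL : LipschitzOnWith ((‖e‖₊ + K) * 1) B J := hAL.comp hnegL hJneg
  have hHL : LipschitzOnWith (K + K * 1) H J := hK.add hpneg
  have hAac := hAL.absolutelyContinuousOnInterval
  have hBac := hBL.absolutelyContinuousOnInterval
  set g : ℝ → Y := fun u => (H u)⁻¹ • (A u + B u) with hg
  have hgac : AbsolutelyContinuousOnInterval g (-u₀) u₀ :=
    (hHL.absolutelyContinuousOnInterval_inv fun u hu => hHpos u (hJI hu)).smul (hAac.add hBac)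
  have hderiv : ∀ᵐ u, u ∈ Set.uIcc (-u₀) u₀ → HasDerivAt g 0 u := by
    filter_upwards [hK.absolutelyContinuousOnInterval.ae_differentiableAt,
      hpneg.absolutelyContinuousOnInterval.ae_differentiableAt,
      hAac.boundedVariationOn.ae_differentiableAt_of_mem_uIcc,
      hBac.boundedVariationOn.ae_differentiableAt_of_mem_uIcc] with u hu1 hu2 hu3 hu4 hu
    specialize hu1 hu
    specialize hu2 hu
    specialize hu3 hu
    specialize hu4 hu
    have huI : u ∈ I := hJI hu
    have hHu := hHpos u huI
    have hgd : DifferentiableAt ℝ g u := ((hu1.add hu2).inv hHu.ne').smul (hu3.add hu4)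
    have hyd : HasDerivAt y ((1 : ℝ) • e + deriv p u • c) u :=
      ((hasDerivAt_id u).smul_const e).add (hu1.hasDerivAt.smul_const c)
    have hnear : ∀ᶠ s in 𝓝 u, s ∈ I := hIo.mem_nhds huI
    have hg1 : ∀ᶠ s in 𝓝 u, ‖g s‖ = 1 := hnear.mono fun s hs => by
      simp only [hg]
      rw [norm_smul, hABnorm s hs, norm_inv, Real.norm_of_nonneg (hHpos s hs).le,
        inv_mul_cancel₀ (hHpos s hs).ne']
    have hnd : ¬ DifferentiableAt ℝ (fun s => ‖y s - -y (-u)‖) u := by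
      have hval : ∀ φ : X →L[ℝ] ℝ, φ c = 1 → φ (y u - -y (-u)) = ‖y u - -y (-u)‖ :=
        fun φ hφ => by
          rw [sub_neg_eq_add, hchord, norm_smul, hc, mul_one, Real.norm_of_nonneg hHu.le,
            map_smul, hφ, smul_eq_mul, mul_one]
      refine not_differentiableAt_norm_sub_of_two_supports h₁ h₂ hyd (hval _ hc₁) (hval _ hc₂) ?_
      simpa [hc₁, hc₂] using he
    -- Applied to the curve `s ↦ A s + B u`, which equals `H u • g u` at `s = u`.
    have hzero : deriv g u = 0 := by
      refine eq_zero_of_hasDerivAt_of_not_differentiableAt_norm hdim hgd.hasDerivAt hg1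
        (hu3.hasDerivAt.add_const (B u)) hHu ?_ fun hd => hnd (hd.congr_of_eventuallyEq ?_)
      · simp only [hg]
        rw [smul_inv_smul₀ hHu.ne']
      · exact hnear.mono fun s hs => (hAB s hs u huI).symm
    exact hzero ▸ hgd.hasDerivAt
  obtain ⟨C, hC⟩ := hgac.const_of_ae_hasDerivAt_zero hderiv
  have h0J : (0 : ℝ) ∈ Set.uIcc (-u₀) u₀ := by
    rw [Set.mem_uIcc]
    rcases le_total 0 u₀ with h | h
    · left; constructor <;> linarith
    · right; constructor <;> linarith
  have hg0 : g 0 = F c := by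
    have hp0 : p 0 = 1 := ballSectionTop_zero e hc
    have hy0 : y 0 = c := by rw [hydef, hp0]; simp
    simp only [hg, hH, hA, hB, neg_zero, hy0, hp0]
    module
  have hgu : g u₀ = F c := by rw [hC u₀ Set.right_mem_uIcc, ← hC 0 h0J, hg0]
  rw [← hgu]
  simp only [hg]
  rw [smul_inv_smul₀ (hHpos u₀ hu₀).ne']

end Directions

/-! ### Antipodes and dimension under sphere isometries -/

section SphereBijections

variable {X Y : Type*} [NormedAddCommGroup X] [NormedSpace ℝ X] [NormedAddCommGroup Y]
  [NormedSpace ℝ Y]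

theorem eq_neg_of_norm_sub_eq_two [StrictConvexSpace ℝ X] {x y : X} (hx : ‖x‖ = 1) (hy : ‖y‖ = 1)
    (h : ‖x - y‖ = 2) : y = -x := by
  have := eq_of_norm_eq_of_norm_add_eq (x := x) (y := -y) (by rw [norm_neg, hx, hy])
    (by rw [← sub_eq_add_neg, h, norm_neg, hx, hy]; norm_num)
  rw [this, neg_neg]

/-- The preimage of `-f x` is at distance 2 from `x`; strict convexity of `X` alone leaves only
`-x`. -/
theorem Isometry.sphere_map_neg [StrictConvexSpace ℝ X]
    {f : Metric.sphere (0 : X) 1 → Metric.sphere (0 : Y) 1} (hf : Isometry f)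
    (hs : Function.Surjective f) (x : Metric.sphere (0 : X) 1) : f (-x) = -f x := by
  obtain ⟨y, hy⟩ := hs (-f x)
  have h1 : ‖(x : X) - y‖ = 2 := by
    rw [← dist_eq_norm, ← Subtype.dist_eq, ← hf.dist_eq, hy, Subtype.dist_eq, dist_eq_norm]
    have : ‖((f x : Y))‖ = 1 := norm_eq_of_mem_sphere _
    rw [coe_neg_sphere, sub_neg_eq_add, ← two_smul ℝ, norm_smul, this]
    norm_num
  have h2 := eq_neg_of_norm_sub_eq_two (norm_eq_of_mem_sphere x) (norm_eq_of_mem_sphere y) h1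
  have : y = -x := Subtype.ext h2
  rw [← this, hy]

theorem exists_eq_smul_add_smul_of_dual {φ : X →L[ℝ] ℝ} (hdim : finrank ℝ X = 2) {c e : X}
    (hc : c ≠ 0) (hφc : φ c = 0) (hφe : φ e = 1) (x : X) : ∃ t : ℝ, x = φ x • e + t • c := by
  have hli : LinearIndependent ℝ ![e, c] := by
    rw [LinearIndependent.pair_iff]
    intro s t h
    have hs : s = 0 := by simpa [hφc, hφe] using congrArg φ h
    subst hs
    simpa [hc] using h
  obtain ⟨a, b, rfl⟩ := exists_eq_smul_add_smul_of_finrank_eq_two hdim hli x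
  exact ⟨b, by simp [hφc, hφe]⟩

/-- The complement of a line in a space of dimension at least three is connected, whereas removing
a pair of antipodes disconnects the unit circle of a plane. -/
theorem finrank_eq_two_of_sphere_bijective [StrictConvexSpace ℝ X] (hdim : finrank ℝ X = 2)
    {f : Metric.sphere (0 : X) 1 → Metric.sphere (0 : Y) 1} (hf : Isometry f)
    (hb : Function.Bijective f) {φ : X →L[ℝ] ℝ} {c : Metric.sphere (0 : X) 1} (hφc : φ c = 0)
    {e : X} (hφe : φ e = 1) : finrank ℝ Y = 2 := by
  have hc1 : ‖(c : X)‖ = 1 := norm_eq_of_mem_sphere c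
  have hc0 : (c : X) ≠ 0 := fun h => by simp [h] at hc1
  have he0 : e ≠ 0 := fun h => by simp [h] at hφe
  set a : Y := (f c : Y) with ha
  have ha1 : ‖a‖ = 1 := norm_eq_of_mem_sphere (f c)
  have ha0 : a ≠ 0 := fun h => by simp [h] at ha1
  have hneg := hf.sphere_map_neg hb.2
  set E := Submodule.span ℝ {a} with hE
  have hmem : ∀ x : Metric.sphere (0 : X) 1, (f x : Y) ∈ E → φ x = 0 := by
    intro x hx
    obtain ⟨t, ht⟩ := Submodule.mem_span_singleton.1 hx
    have ht1 : |t| = 1 := by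
      have : ‖(f x : Y)‖ = 1 := norm_eq_of_mem_sphere _
      simpa [← ht, norm_smul, ha1] using this
    rcases eq_or_eq_neg_of_abs_eq ht1 with rfl | rfl
    · have : f x = f c := Subtype.ext (by rw [← ht, one_smul])
      rw [hb.1 this, hφc]
    · have : f x = f (-c) := Subtype.ext (by
        rw [hneg, coe_neg_sphere, ← ht, neg_smul, one_smul])
      rw [hb.1 this, coe_neg_sphere, map_neg, hφc, neg_zero]
  let x₀ : Metric.sphere (0 : X) 1 := ⟨‖e‖⁻¹ • e, by simp [norm_smul, he0]⟩
  have hx₀ : 0 < φ x₀ := by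
    have : 0 < ‖e‖ := norm_pos_iff.2 he0
    simpa [x₀, hφe] using this
  have hfx₀ : (f x₀ : Y) ∉ E := fun h => hx₀.ne' (hmem _ h)
  have hle : Module.rank ℝ (Y ⧸ E) ≤ 1 := by
    by_contra! hcodim
    have hconn := (isConnected_compl_of_one_lt_codim hcodim).isPreconnected
    let i : Metric.sphere (0 : X) 1 ≃ᵢ Metric.sphere (0 : Y) 1 :=
      ⟨Equiv.ofBijective f hb, hf⟩
    have hi : ∀ x, i.symm (f x) = x := fun x => i.symm_apply_apply x
    have hne : ∀ v : ((E : Set Y)ᶜ : Set Y), (v : Y) ≠ 0 := fun v h => v.2 (h ▸ E.zero_mem)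
    let N : ((E : Set Y)ᶜ : Set Y) → Metric.sphere (0 : Y) 1 :=
      fun v => ⟨‖(v : Y)‖⁻¹ • (v : Y), by simp [norm_smul, hne v]⟩
    have hN : Continuous N := by
      refine Continuous.subtype_mk ?_ _
      exact (continuous_subtype_val.norm.inv₀ fun v => norm_ne_zero_iff.2 (hne v)).smul
        continuous_subtype_val
    have hNf : ∀ (x : Metric.sphere (0 : X) 1) (hx : (f x : Y) ∈ ((E : Set Y)ᶜ : Set Y)),
        N ⟨f x, hx⟩ = f x := fun x hx => Subtype.ext (by simp [N])
    -- `T` takes both signs on a connected set; at a zero, the preimage is `c` or `-c`, whose image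
    -- lies in the excluded line `E`.
    let T : ((E : Set Y)ᶜ : Set Y) → ℝ := fun v => φ (i.symm (N v))
    have hT : Continuous T :=
      φ.continuous.comp (continuous_subtype_val.comp (i.symm.continuous.comp hN))
    have : PreconnectedSpace ((E : Set Y)ᶜ : Set Y) := Subtype.preconnectedSpace hconn
    have hfx₁ : (f (-x₀) : Y) ∉ E := fun h => by
      have := hmem _ h
      rw [coe_neg_sphere, map_neg, neg_eq_zero] at this
      exact hx₀.ne' this
    obtain ⟨v, hv⟩ := mem_range_of_exists_le_of_exists_ge hT (c := 0)
      ⟨⟨f (-x₀), hfx₁⟩, by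
        simp only [T, hNf, hi, coe_neg_sphere, map_neg]
        linarith⟩
      ⟨⟨f x₀, hfx₀⟩, by
        simp only [T, hNf, hi]
        exact hx₀.le⟩
    obtain ⟨t, ht⟩ := exists_eq_smul_add_smul_of_dual hdim hc0 hφc hφe (i.symm (N v) : X)
    have hv' : φ (i.symm (N v)) = 0 := hv
    rw [hv', zero_smul, zero_add] at ht
    have ht1 : |t| = 1 := by
      have : ‖(i.symm (N v) : X)‖ = 1 := norm_eq_of_mem_sphere _
      simpa [ht, norm_smul, hc1] using this
    have hNv : (N v : Y) ∈ E := by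
      have hf' : N v = f (i.symm (N v)) := (i.apply_symm_apply (N v)).symm
      rcases eq_or_eq_neg_of_abs_eq ht1 with rfl | rfl
      · rw [show i.symm (N v) = c from Subtype.ext (by rw [ht, one_smul])] at hf'
        rw [hf']
        exact Submodule.mem_span_singleton_self a
      · rw [show i.symm (N v) = -c from Subtype.ext (by
          rw [ht, neg_smul, one_smul, coe_neg_sphere]), hneg] at hf'
        rw [hf', coe_neg_sphere]
        exact E.neg_mem (Submodule.mem_span_singleton_self a)
    exact v.2 ((E.smul_mem_iff (inv_ne_zero (norm_ne_zero_iff.2 (hne v)))).1 hNv)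
  have hErank : Module.rank ℝ E = 1 := by
    rw [← finrank_eq_rank, finrank_span_singleton ha0, Nat.cast_one]
  have hY : Module.rank ℝ Y ≤ 2 := by
    rw [← rank_quotient_add_rank_of_divisionRing E, hErank, ← one_add_one_eq_two]
    exact add_le_add_left hle 1
  have hfin : FiniteDimensional ℝ Y := by
    rw [FiniteDimensional, ← rank_lt_aleph0_iff]
    exact hY.trans_lt (Cardinal.natCast_lt_aleph0 (n := 2))
  refine le_antisymm (finrank_le_of_rank_le hY) ?_
  have hli : LinearIndependent ℝ ![a, (f x₀ : Y)] := by
    rw [LinearIndependent.pair_iff' ha0]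
    exact fun t ht => hfx₀ (Submodule.mem_span_singleton.2 ⟨t, ht⟩)
  simpa using hli.fintype_card_le_finrank

end SphereBijections

/-! ### Two supports and the conclusion -/

theorem exists_two_supports_of_not_isSmoothPoint {X : Type*} [NormedAddCommGroup X]
    [NormedSpace ℝ X] {c : Metric.sphere (0 : X) 1} (hc : ¬ IsSmoothPoint c) :
    ∃ φ₁ φ₂ : X →L[ℝ] ℝ, φ₁ ≠ φ₂ ∧ (φ₁ c = 1 ∧ ‖φ₁‖ = 1) ∧ (φ₂ c = 1 ∧ ‖φ₂‖ = 1) := by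
  have hc1 : ‖(c : X)‖ = 1 := norm_eq_of_mem_sphere c
  obtain ⟨φ, hφ, hφc⟩ := exists_dual_vector ℝ (c : X) (by rw [hc1]; exact one_ne_zero)
  rw [hc1] at hφc
  by_contra! h
  refine hc ⟨φ, ⟨by simpa using hφc, hφ⟩, fun ψ hψ => ?_⟩
  by_contra hne
  exact h ψ φ hne hψ (by simpa using hφc) hφ

theorem proposition4p2 {X : Type u} [NormedAddCommGroup X] [NormedSpace ℝ X] [CompleteSpace X]
    [StrictConvexSpace ℝ X] (hdim : Module.finrank ℝ X = 2)
    (c : Metric.sphere (0 : X) 1) (hc : ¬ IsSmoothPoint c) :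
    IsSpecialPoint.{u, v} c := by
  intro Y _ _ _ f hf hb y z hyz
  have hsph : ∀ x : Metric.sphere (0 : X) 1, ‖(x : X)‖ = 1 := norm_eq_of_mem_sphere
  have hnorm : ∀ x x' : Metric.sphere (0 : X) 1, ‖(f x : Y) - f x'‖ = ‖(x : X) - x'‖ := by
    intro x x'
    rw [← dist_eq_norm, ← dist_eq_norm, ← Subtype.dist_eq, ← Subtype.dist_eq, hf.dist_eq]
  rw [hnorm, and_iff_left rfl]
  rcases eq_or_ne y z with rfl | hne
  · simp
  obtain ⟨φ₁, φ₂, hφ, ⟨hc₁, h₁⟩, hc₂, h₂⟩ := exists_two_supports_of_not_isSmoothPoint hc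
  obtain ⟨e₀, he₀⟩ : ∃ e, φ₁ e ≠ φ₂ e := by
    by_contra! h
    exact hφ (ContinuousLinearMap.ext h)
  set φ := φ₁ - φ₂ with hφdef
  set e : X := (φ e₀)⁻¹ • e₀ with he
  have hφe₀ : φ e₀ ≠ 0 := sub_ne_zero.2 he₀
  have hφe : φ e = 1 := by simp [he, hφe₀]
  have hφc : φ c = 0 := by simp [hφdef, hc₁, hc₂]
  have hφe' : φ₁ e ≠ φ₂ e := by
    rw [← sub_ne_zero]
    exact ne_of_eq_of_ne hφe one_ne_zero
  have hc0 : (c : X) ≠ 0 := fun h => by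
    have := hsph c
    simp [h] at this
  have hdimY := finrank_eq_two_of_sphere_bijective hdim hf hb hφc hφe
  have hneg := hf.sphere_map_neg hb.2
  classical
  let F : X → Y := fun x => if h : ‖x‖ = 1 then (f ⟨x, by simpa using h⟩ : Y) else 0
  have hFf : ∀ x : Metric.sphere (0 : X) 1, F x = f x := fun x => dif_pos (hsph x)
  have hF : ∀ x y, ‖x‖ = 1 → ‖y‖ = 1 → ‖F x - F y‖ = ‖x - y‖ := by
    intro x y hx hy
    lift x to Metric.sphere (0 : X) 1 using by simpa using hx
    lift y to Metric.sphere (0 : X) 1 using by simpa using hy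
    rw [hFf, hFf, hnorm]
  have hodd : ∀ x, ‖x‖ = 1 → F (-x) = -F x := by
    intro x hx
    lift x to Metric.sphere (0 : X) 1 using by simpa using hx
    rw [hFf, ← coe_neg_sphere, hFf, hneg, coe_neg_sphere]
  set d := ‖(y : X) - z‖ with hd
  have hdpos : 0 < d := norm_pos_iff.2 (sub_ne_zero.2 fun h => hne (Subtype.ext h))
  obtain ⟨t, ht⟩ := exists_eq_smul_add_smul_of_dual hdim hc0 hφc hφe (y : X)
  set w := φ y with hw
  have hz : (z : X) = w • e + (t - d) • (c : X) := by
    rw [eq_sub_of_add_eq' (sub_eq_iff_eq_add.1 hyz).symm, ht]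
    module
  have hz' : ((-z : Metric.sphere (0 : X) 1) : X) = (-w) • e + (d - t) • (c : X) := by
    rw [coe_neg_sphere, hz]
    module
  have hy' : ((-y : Metric.sphere (0 : X) 1) : X) = (-w) • e + (-t) • (c : X) := by
    rw [coe_neg_sphere, ht]
    module
  -- `y` is the upper end of the chord at `w`, and by symmetry `-z` is that at `-w`.
  obtain ⟨hwI, htop⟩ := eq_ballSectionTop_of_lt (e := e) (hsph c) (sub_lt_self t hdpos)
    (by rw [← hz]; exact hsph z) (by rw [← ht]; exact hsph y)
  obtain ⟨-, htop'⟩ := eq_ballSectionTop_of_lt (e := e) (u := -w) (s := -t) (t := d - t) (hsph c)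
    (by linarith) (by rw [← hy']; exact hsph _) (by rw [← hz']; exact hsph _)
  have key := isometry_ballSectionEnd_add_neg hdimY (hsph c) h₁.le h₂.le hc₁ hc₂ hφe' hF hodd hwI
  rw [ballSectionEnd, ballSectionEnd, ← htop, ← htop', ← ht, ← hz', hFf, hFf, hFf, hneg,
    coe_neg_sphere, ← sub_eq_add_neg] at key
  rw [key, add_sub_cancel]
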